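/- Let $n\ge 1$ and let $\gamma:J\to\mathbb{RP}^{n-1}$ be a smooth convex curve, where $J$ is either the circle $\mathbb S^1$ or a non-degenerate interval $I\subseteq\mathbb R$ (open, closed or half-open, bounded or not). Here $\gamma$ is called convex if, for every hyperplane $H\subset\mathbb{RP}^{n-1}$, the sum of the local multiplicities of all intersections of $\gamma$ with $H$ is at most $n-1$; the local multiplicity at $t$ is the order of vanishing at $t$ of $\varphi\circ g$, where $g$ is a local smooth lift of $\gamma$ to $\mathbb R^n\setminus\{0\}$ and $H=\{\varphi=0\}$. For $t\in J$ let $\gamma_{\mathcal F}(t)$ be the osculating flag of $\gamma$ at $t$, that is, the complete flag in $\mathbb R^n$ whose $k$-dimensional subspace is spanned by $g(t),g'(t),\dots,g^{(k-1)}(t)$. Two complete flags in $\mathbb R^n$ are transversal if, for every $1\le i\le n-1$, the $i$-dimensional subspace of the first meets the $(n-i)$-dimensional subspace of the second only in $0$. For a complete flag $f$ let $\sharp_{\gamma,f}\in\{0,1,2,\dots,\infty\}$ be the number of $t\in J$ for which $\gamma_{\mathcal F}(t)$ and $f$ are not transversal, and let $\sharp_\gamma=\sup_f\sharp_{\gamma,f}$,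 the supremum being over all complete flags $f$ in $\mathbb R^n$. Then there is a complete flag $f$ with $\sharp_{\gamma,f}\ge\frac{n^3-n}{6}$; in particular $$\sharp_\gamma\ \ge\ \frac{n^3-n}{6}.$$ -/

import Mathlib

open scoped ContDiff

namespace ConvexCurve

/-- `g` is a smooth lift to `ℝⁿ ∖ {0}`, on a neighbourhood of `t` relative to `D`, of the curve `γ`
in the projective space `ℝP^{n-1}`. Only the values of `γ` on `D` matter. -/
def IsLocalLift {n : ℕ} (γ : ℝ → Projectivization ℝ (Fin n → ℝ)) (D : Set ℝ) (t : ℝ)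
    (g : ℝ → Fin n → ℝ) : Prop :=
  ∃ U : Set ℝ, IsOpen U ∧ t ∈ U ∧ ContDiffOn ℝ ∞ g (U ∩ D) ∧
    ∀ s ∈ U ∩ D, ∃ hs : g s ≠ 0, γ s = Projectivization.mk ℝ (g s) hs

/-- The curve `γ : D → ℝP^{n-1}` is smooth: near every point it is the projectivization of a
smooth nowhere vanishing curve in `ℝⁿ`. -/
def IsSmooth {n : ℕ} (γ : ℝ → Projectivization ℝ (Fin n → ℝ)) (D : Set ℝ) : Prop :=
  ∀ t ∈ D, ∃ g, IsLocalLift γ D t g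

/-- The local multiplicity at the parameter `t` of the intersection of `γ` with the hyperplane
`φ = 0`: the order of vanishing at `t` of `φ ∘ g`, where `g` is a local lift of `γ`. It does not
depend on the lift, it is `0` if `γ t` is not in the hyperplane, and it is `⊤` if all derivatives
vanish. Derivatives are taken within `D`, hence one-sided at an endpoint of an interval `D`. -/
noncomputable def localMultiplicity {n : ℕ} (γ : ℝ → Projectivization ℝ (Fin n → ℝ)) (D : Set ℝ)
    (φ : Module.Dual ℝ (Fin n → ℝ)) (t : ℝ) : ℕ∞ :=
  ⨆ (k : ℕ) (_ : ∃ g, IsLocalLift γ D t g ∧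
    ∀ j < k, iteratedDerivWithin j (fun s => φ (g s)) D t = 0), (k : ℕ∞)

/-- The `k`-dimensional linear subspace osculating `γ` at `t`, spanned by
`g t, g' t, …, g^{(k-1)} t` for a local lift `g` of `γ` (the span does not depend on `g`). -/
noncomputable def osculatingSubspace {n : ℕ} (γ : ℝ → Projectivization ℝ (Fin n → ℝ)) (D : Set ℝ)
    (k : ℕ) (t : ℝ) : Submodule ℝ (Fin n → ℝ) :=
  Submodule.span ℝ {v | ∃ g, IsLocalLift γ D t g ∧ ∃ j < k, v = iteratedDerivWithin j g D t}

/-- The osculating flag of `γ` at `t`, from dimension `0` to dimension `n`. -/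
noncomputable def osculatingFlag {n : ℕ} (γ : ℝ → Projectivization ℝ (Fin n → ℝ)) (D : Set ℝ)
    (t : ℝ) : Fin (n + 1) → Submodule ℝ (Fin n → ℝ) :=
  fun i => osculatingSubspace γ D i t

/-- Complete flags in `ℝⁿ`. -/
structure CompleteFlag (n : ℕ) where
  /-- The `i`-dimensional subspace of the flag. -/
  subspace : Fin (n + 1) → Submodule ℝ (Fin n → ℝ)
  mono : Monotone subspace
  finrank_eq : ∀ i, Module.finrank ℝ (subspace i) = i

/-- Transversality of two flags: the `i`-dimensional subspace of the first one meets the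
`(n-i)`-dimensional subspace of the second one in `0` only. -/
def Transversal {n : ℕ} (F G : Fin (n + 1) → Submodule ℝ (Fin n → ℝ)) : Prop :=
  ∀ i j : Fin (n + 1), (i : ℕ) + j = n → F i ⊓ G j = ⊥

/-- `γ` is smooth on `D`, and for every hyperplane the sum of all local multiplicities of the
intersection, over the parameters in `P ⊆ D`, is at most `n - 1`. -/
def IsConvexWith {n : ℕ} (γ : ℝ → Projectivization ℝ (Fin n → ℝ)) (D P : Set ℝ) : Prop :=
  IsSmooth γ D ∧ ∀ φ : Module.Dual ℝ (Fin n → ℝ), φ ≠ 0 → ∀ s : Finset ℝ, (s : Set ℝ) ⊆ P →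
    ∑ t ∈ s, localMultiplicity γ D φ t ≤ ((n - 1 : ℕ) : ℕ∞)

/-- The number of parameters `t` in `P` at which `f` and the osculating flag of `γ` are not
transversal. -/
noncomputable def momentsWith {n : ℕ} (γ : ℝ → Projectivization ℝ (Fin n → ℝ)) (D P : Set ℝ)
    (f : CompleteFlag n) : ℕ∞ :=
  {t ∈ P | ¬ Transversal (osculatingFlag γ D t) f.subspace}.encard

/-- Smooth (globally) convex curves `γ : I → ℝP^{n-1}` on an interval `I`. -/
def IsConvexOn {n : ℕ} (I : Set ℝ) (γ : ℝ → Projectivization ℝ (Fin n → ℝ)) : Prop :=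
  IsConvexWith γ I I

/-- The number of moments `t ∈ I` of non-transversality between the osculating flag curve of
`γ : I → ℝP^{n-1}` and the flag `f`. -/
noncomputable def momentsOn {n : ℕ} (I : Set ℝ) (γ : ℝ → Projectivization ℝ (Fin n → ℝ))
    (f : CompleteFlag n) : ℕ∞ :=
  momentsWith γ I I f

/-- The supremum over all complete flags of the number of moments of non-transversality. -/
noncomputable def sharpOn {n : ℕ} (I : Set ℝ) (γ : ℝ → Projectivization ℝ (Fin n → ℝ)) : ℕ∞ :=
  ⨆ f : CompleteFlag n, momentsOn I γ f

/-- Smooth (globally) convex closed curves `γ : 𝕊¹ → ℝP^{n-1}`, with `𝕊¹ = ℝ/ℤ`. Smoothness and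
derivatives are those of the periodic curve `t ↦ γ (t mod 1)` on `ℝ`; each point of `𝕊¹` is counted
once, through its representative in `[0, 1)`. -/
def IsConvexClosed {n : ℕ} (γ : UnitAddCircle → Projectivization ℝ (Fin n → ℝ)) : Prop :=
  IsConvexWith (fun t : ℝ => γ (t : UnitAddCircle)) Set.univ (Set.Ico 0 1)

/-- The number of moments in `𝕊¹` of non-transversality between the osculating flag curve of
`γ : 𝕊¹ → ℝP^{n-1}` and the flag `f`. -/
noncomputable def momentsClosed {n : ℕ} (γ : UnitAddCircle → Projectivization ℝ (Fin n → ℝ))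
    (f : CompleteFlag n) : ℕ∞ :=
  momentsWith (fun t : ℝ => γ (t : UnitAddCircle)) Set.univ (Set.Ico 0 1) f

/-- The supremum over all complete flags of the number of moments of non-transversality. -/
noncomputable def sharpClosed {n : ℕ} (γ : UnitAddCircle → Projectivization ℝ (Fin n → ℝ)) : ℕ∞ :=
  ⨆ f : CompleteFlag n, momentsClosed γ f

end ConvexCurve

namespace ConvexCurve

open Filter Topology Set

/-! Everything happens in an arbitrarily short arc starting at an interior parameter `t₀`. Convexity
makes `g, …, g^{(n-1)}` independent there: otherwise a hyperplane would meet the curve with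
multiplicity at least `n` at one point. A flag is a basis of linear forms `φ 0, …, φ (n-1)`, its
subspaces being the common kernels of initial segments, and transversality fails at `τ` as soon as
the Wronskian of the first `k` coordinates vanishes for some `k < n`. So a basis is wanted whose
Wronskians have many distinct zeros.

Start with coordinates vanishing at `t₀` to orders `n-1, …, 1, 0` and sort these orders increasingly
by swaps. A swap exchanges consecutive orders `w j + 1 = w i`, `i < j`, by perturbing `φ i` to `φ i
- ε (c i / c j) φ j`. At scale `τ = ε σ`, the `k`-th Wronskian with `i < k ≤ j` is then a nonzero
factor times approximately `1 - ρ_k / σ`, where `ρ_k` is a ratio of Vandermonde determinants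
(`tendsto_leadingMinor_update_scaled`). The `ρ_k` are positive and strictly increase with `k`, so `j
- i` distinct zeros appear near `0`, while older zeros, detected by sign changes, survive a small
perturbation (`HasZerosOfOrders.swap`). Selection sort gains `1 + 2 + ⋯ + (n-1-i)` zeros for the
`i`-th row, in total the tetrahedral number `(n³ - n)/6`. -/

/-- The `k × k` minor of the first `k` row vectors `φ` against the first `k` of the moving vectors
`H`. If `H b` is the `b`-th derivative of a curve, this is the Wronskian of the first `k`
coordinates `φ a ⬝ᵥ H 0`. -/
noncomputable def leadingMinor {n : ℕ} (H : ℕ → ℝ → Fin n → ℝ) (φ : ℕ → Fin n → ℝ) (k : ℕ)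
    (τ : ℝ) : ℝ :=
  (Matrix.of fun a b : Fin k => φ a ⬝ᵥ H b τ).det

/-- The coordinate `x ⬝ᵥ H 0 τ` behaves like `c * τ ^ w` as `τ → 0+`, together with all its
derivatives `x ⬝ᵥ H b τ`. -/
def HasOrder {n : ℕ} (H : ℕ → ℝ → Fin n → ℝ) (x : Fin n → ℝ) (w : ℕ) (c : ℝ) : Prop :=
  ∀ b, Tendsto (fun τ => τ ^ b * (τ ^ w)⁻¹ * (x ⬝ᵥ H b τ)) (𝓝[>] 0)
    (𝓝 (c * (w.descFactorial b : ℝ)))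

/-- The Vandermonde determinant of the first `k` values of `w`. -/
noncomputable def vandermondeDet (w : ℕ → ℕ) (k : ℕ) : ℝ :=
  (Matrix.vandermonde fun a : Fin k => (w a : ℝ)).det

variable {n : ℕ} {H : ℕ → ℝ → Fin n → ℝ}

/-! ### Vandermonde asymptotics of Wronskians. -/

theorem vandermondeDet_succ (w : ℕ → ℕ) (k : ℕ) :
    vandermondeDet w (k + 1) =
      vandermondeDet w k * ∏ l ∈ Finset.range k, ((w k : ℝ) - w l) := by
  have key : ∀ k, vandermondeDet w k =
      ∏ a ∈ Finset.range k, ∏ l ∈ Finset.range a, ((w a : ℝ) - w l) := by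
    intro k
    unfold vandermondeDet
    rw [Matrix.det_vandermonde, Finset.prod_comm' (t' := Finset.univ) (s' := fun a => Finset.Iio a)
      (by simp), Finset.prod_range]
    refine Finset.prod_congr rfl fun a _ => ?_
    refine Finset.prod_bij' (fun l _ => (l : ℕ))
      (fun l hl => ⟨l, (Finset.mem_range.1 hl).trans a.2⟩) ?_ ?_ ?_ ?_ ?_
    all_goals simp only [Finset.mem_Iio, Finset.mem_range, Fin.lt_def, implies_true]
    all_goals exact fun _ h => h
  rw [key, key, Finset.prod_range_succ]

theorem vandermondeDet_ne_zero {w : ℕ → ℕ} {k : ℕ} (hw : InjOn w (Iio k)) :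
    vandermondeDet w k ≠ 0 := by
  unfold vandermondeDet
  rw [Matrix.det_vandermonde_ne_zero_iff]
  intro a b hab
  exact Fin.ext (hw a.2 b.2 (Nat.cast_injective (R := ℝ) hab))

/-- Scaling row `a` by `τ ^ (-w a)` and column `b` by `τ ^ b` makes every entry converge. The limit
entries are `c a` times falling factorials of `w a`, monic polynomials of degree `b` in `w a`, so
the limit determinant reduces to a Vandermonde one. -/
theorem tendsto_leadingMinor {φ : ℕ → Fin n → ℝ} {w : ℕ → ℕ} {c : ℕ → ℝ} {k : ℕ}
    (h : ∀ a < k, HasOrder H (φ a) (w a) (c a)) :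
    Tendsto (fun τ => τ ^ (∑ b ∈ Finset.range k, b) * (τ ^ (∑ a ∈ Finset.range k, w a))⁻¹ *
      leadingMinor H φ k τ) (𝓝[>] 0) (𝓝 ((∏ a ∈ Finset.range k, c a) * vandermondeDet w k)) := by
  have h1 : ∀ τ : ℝ, τ ^ (∑ b ∈ Finset.range k, b) * (τ ^ (∑ a ∈ Finset.range k, w a))⁻¹ *
      leadingMinor H φ k τ = (Matrix.of fun a b : Fin k =>
        τ ^ (b : ℕ) * (τ ^ w a)⁻¹ * (φ a ⬝ᵥ H b τ)).det := by
    intro τ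
    have e1 := Matrix.det_mul_row (fun b : Fin k => τ ^ (b : ℕ))
      (Matrix.of fun a b : Fin k => (τ ^ w a)⁻¹ * (φ a ⬝ᵥ H b τ))
    have e2 := Matrix.det_mul_column (fun a : Fin k => (τ ^ w a)⁻¹)
      (Matrix.of fun a b : Fin k => (φ a ⬝ᵥ H b τ))
    simp only [Matrix.of_apply] at e1 e2
    simp only [mul_assoc]
    rw [e1, e2, Finset.prod_inv_distrib, Finset.prod_pow_eq_pow_sum, Finset.prod_pow_eq_pow_sum,
      Finset.sum_range, Finset.sum_range]
    rfl
  have h2 : (∏ a ∈ Finset.range k, c a) * vandermondeDet w k =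
      (Matrix.of fun a b : Fin k => c a * ((w a).descFactorial b : ℝ)).det := by
    have e1 := Matrix.det_mul_column (fun a : Fin k => c a)
      (Matrix.of fun a b : Fin k => ((w a).descFactorial b : ℝ))
    simp only [Matrix.of_apply] at e1
    rw [e1, vandermondeDet, Matrix.det_eval_matrixOfPolynomials_eq_det_vandermonde _
      (fun b : Fin k => descPochhammer ℝ b) (fun b => descPochhammer_natDegree ℝ b)
      (fun b => monic_descPochhammer ℝ b), Finset.prod_range]
    simp only [descPochhammer_eval_eq_descFactorial]
  simp only [h1]
  rw [h2]
  have h3 : Continuous fun M : Matrix (Fin k) (Fin k) ℝ => M.det := by fun_prop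
  refine (h3.tendsto _).comp ?_
  exact tendsto_pi_nhds.2 fun a => tendsto_pi_nhds.2 fun b => h a a.2 b

/-! ### Row operations and continuity of leading minors. -/

theorem leadingMinor_update (φ : ℕ → Fin n → ℝ) {i k : ℕ} (hik : i < k) (x : Fin n → ℝ) (τ : ℝ) :
    leadingMinor H (Function.update φ i x) k τ =
      ((Matrix.of fun a b : Fin k => φ a ⬝ᵥ H b τ).updateRow ⟨i, hik⟩
        fun b => x ⬝ᵥ H b τ).det := by
  unfold leadingMinor
  congr 1
  ext a b
  by_cases h : (a : ℕ) = i
  · have : a = ⟨i, hik⟩ := Fin.ext h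
    subst this
    simp
  · have h' : a ≠ ⟨i, hik⟩ := fun e => h (by simp [e])
    simp [Matrix.updateRow_ne h', Function.update_of_ne h]

theorem leadingMinor_update_of_le (φ : ℕ → Fin n → ℝ) {i k : ℕ} (hik : k ≤ i) (x : Fin n → ℝ)
    (τ : ℝ) : leadingMinor H (Function.update φ i x) k τ = leadingMinor H φ k τ := by
  unfold leadingMinor
  congr 1
  ext a b
  have h : (a : ℕ) ≠ i := by omega
  simp [Function.update_of_ne h]

theorem leadingMinor_update_sub (φ : ℕ → Fin n → ℝ) {i k : ℕ} (hik : i < k) (x y : Fin n → ℝ)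
    (s : ℝ) (τ : ℝ) :
    leadingMinor H (Function.update φ i (x - s • y)) k τ =
      leadingMinor H (Function.update φ i x) k τ -
        s * leadingMinor H (Function.update φ i y) k τ := by
  rw [leadingMinor_update φ hik, leadingMinor_update φ hik, leadingMinor_update φ hik]
  have : (fun b : Fin k => (x - s • y) ⬝ᵥ H b τ) =
      (fun b : Fin k => x ⬝ᵥ H b τ) + (-s) • fun b : Fin k => y ⬝ᵥ H b τ := by
    ext b
    simp [sub_eq_add_neg]
  rw [this, Matrix.det_updateRow_add, Matrix.det_updateRow_smul]
  ring

theorem leadingMinor_eq_zero_of_row_eq (φ : ℕ → Fin n → ℝ) {i j k : ℕ} (hik : i < k) (hjk : j < k)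
    (hij : i ≠ j) (h : φ i = φ j) (τ : ℝ) : leadingMinor H φ k τ = 0 := by
  refine Matrix.det_zero_of_row_eq (i := ⟨i, hik⟩) (j := ⟨j, hjk⟩) (by simpa using hij) ?_
  ext b
  simp [h]

theorem leadingMinor_update_smul_sub (φ : ℕ → Fin n → ℝ) {i j k : ℕ} (hij : i < j) (hjk : j < k)
    (s : ℝ) (τ : ℝ) :
    leadingMinor H (Function.update φ j (s • (φ j - φ i))) k τ = s * leadingMinor H φ k τ := by
  have e : s • (φ j - φ i) = 0 - (-s) • (φ j - (1 : ℝ) • φ i) := by simp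
  have h0 : leadingMinor H (Function.update φ j 0) k τ = 0 := by
    have := leadingMinor_update_sub (H := H) φ hjk (φ j) (φ j) 1 τ
    simpa using this
  have h1 : leadingMinor H (Function.update φ j (φ i)) k τ = 0 :=
    leadingMinor_eq_zero_of_row_eq _ (hij.trans hjk) hjk hij.ne (by simp [hij.ne]) τ
  rw [e, leadingMinor_update_sub φ hjk, leadingMinor_update_sub φ hjk, h0, h1,
    Function.update_eq_self]
  ring

theorem continuous_leadingMinor_left (k : ℕ) (τ : ℝ) :
    Continuous fun φ : ℕ → Fin n → ℝ => leadingMinor H φ k τ := by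
  unfold leadingMinor
  refine Continuous.matrix_det (continuous_matrix fun a b => ?_)
  simp only [Matrix.of_apply, dotProduct]
  fun_prop

theorem continuousOn_leadingMinor {s : Set ℝ} (hH : ∀ b, ContinuousOn (H b) s)
    (φ : ℕ → Fin n → ℝ) (k : ℕ) : ContinuousOn (leadingMinor H φ k) s := by
  have h3 : Continuous fun M : Matrix (Fin k) (Fin k) ℝ => M.det := by fun_prop
  refine h3.comp_continuousOn ?_
  refine continuousOn_pi.2 fun a => continuousOn_pi.2 fun b => ?_
  have : Continuous fun v : Fin n → ℝ => φ a ⬝ᵥ v := by unfold dotProduct; fun_prop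
  exact this.comp_continuousOn (hH b)

namespace HasOrder

theorem of_succ {x : Fin n → ℝ} {w : ℕ} {c : ℝ} (h : HasOrder H x (w + 1) c) :
    HasOrder H x w 0 := by
  intro b
  have h1 : Tendsto (fun τ : ℝ => τ) (𝓝[>] 0) (𝓝 0) := nhdsWithin_le_nhds
  have := h1.mul (h b)
  rw [zero_mul] at this ⊢
  refine this.congr' ?_
  filter_upwards [self_mem_nhdsWithin] with τ hτ
  have : τ ≠ 0 := (mem_Ioi.1 hτ).ne'
  field_simp
  ring

theorem sub_smul {x y : Fin n → ℝ} {w : ℕ} {c d : ℝ} (hx : HasOrder H x w c)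
    (hy : HasOrder H y w d) (s : ℝ) : HasOrder H (x - s • y) w (c - s * d) := by
  intro b
  have := (hx b).sub ((hy b).const_mul s)
  refine (this.congr fun τ => ?_).trans_eq ?_
  · rw [sub_dotProduct, smul_dotProduct, smul_eq_mul]
    ring
  · congr 1
    ring

end HasOrder

/-! ### Vandermonde ratios, which locate the new zeros. -/

theorem vandermondeDet_congr {w w' : ℕ → ℕ} {k : ℕ} (h : ∀ a < k, w a = w' a) :
    vandermondeDet w k = vandermondeDet w' k := by
  unfold vandermondeDet
  congr 2
  ext a
  rw [h a a.2]

/-- The quotient of the Vandermonde determinants of `w` with its `i`-th value replaced by `v`,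
and of `w`. -/
noncomputable def vandermondeRatio (w : ℕ → ℕ) (i v k : ℕ) : ℝ :=
  vandermondeDet (Function.update w i v) k / vandermondeDet w k

/-- The ratio is a product of `(v - w l) / (w i - w l)` over `l < i`. As `v` and `w i` are
consecutive integers and `w l` is neither, numerator and denominator have the same sign. -/
theorem vandermondeRatio_self_succ_pos {w : ℕ → ℕ} {i v : ℕ} (hv : v + 1 = w i)
    (hw : InjOn w (Iio (i + 1))) (hl : ∀ l < i, w l ≠ v) : 0 < vandermondeRatio w i v (i + 1) := by
  have h0 : vandermondeDet w i ≠ 0 := vandermondeDet_ne_zero (hw.mono (Iio_subset_Iio (by omega)))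
  unfold vandermondeRatio
  rw [vandermondeDet_succ, vandermondeDet_succ,
    vandermondeDet_congr (w := Function.update w i v) (w' := w)
      (fun a ha => Function.update_of_ne ha.ne _ _), mul_div_mul_left _ _ h0,
    ← Finset.prod_div_distrib]
  refine Finset.prod_pos fun l hl' => ?_
  rw [Finset.mem_range] at hl'
  rw [Function.update_self, Function.update_of_ne hl'.ne]
  have h1 := hl l hl'
  have h2 : w l ≠ w i := fun e => hl'.ne (hw (by simp; omega) (by simp) e)
  rcases lt_or_gt_of_ne h1 with h3 | h3
  · have a1 : (w l : ℝ) < v := by exact_mod_cast h3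
    have a2 : (w l : ℝ) < w i := by exact_mod_cast (show w l < w i by omega)
    exact div_pos (by linarith) (by linarith)
  · have a1 : (v : ℝ) < w l := by exact_mod_cast h3
    have a2 : (w i : ℝ) < w l := by exact_mod_cast (show w i < w l by omega)
    exact div_pos_of_neg_of_neg (by linarith) (by linarith)

/-- Passing from `k` to `k + 1` multiplies the ratio by `(w k - v) / (w k - w i) > 1`; all other
factors cancel. This monotonicity keeps the new zeros of different minors apart. -/
theorem vandermondeRatio_lt_succ {w : ℕ → ℕ} {i v k : ℕ} (hv : v + 1 = w i) (hik : i < k)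
    (hw : InjOn w (Iio (k + 1))) (hk : w i < w k) (hpos : 0 < vandermondeRatio w i v k) :
    vandermondeRatio w i v k < vandermondeRatio w i v (k + 1) := by
  have h1 : vandermondeRatio w i v (k + 1) =
      vandermondeRatio w i v k * (((w k : ℝ) - v) / (w k - w i)) := by
    unfold vandermondeRatio
    rw [vandermondeDet_succ, vandermondeDet_succ, mul_div_mul_comm, ← Finset.prod_div_distrib]
    congr 1
    rw [Finset.prod_eq_single_of_mem i (by simpa using hik), Function.update_self,
      Function.update_of_ne hik.ne']
    intro l hl hli
    rw [Finset.mem_range] at hl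
    rw [Function.update_of_ne hli, Function.update_of_ne hik.ne']
    refine div_self (sub_ne_zero.2 fun e => ?_)
    exact hl.ne' (hw (by simp) (by simp; omega) (Nat.cast_injective e))
  rw [h1]
  refine lt_mul_of_one_lt_right hpos ?_
  have a1 : (w i : ℝ) < w k := by exact_mod_cast hk
  have a2 : (v : ℝ) + 1 = w i := by exact_mod_cast hv
  rw [one_lt_div (by linarith)]
  linarith

/-- Replacing the row `φ i` of order `w i` by `φ i - ε (c i / c j) φ j`, where `φ j` has order
`w i - 1`, creates in the `k`-th minor, `i < k ≤ j`, a zero close to `ε` times a quotient of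
Vandermonde determinants. -/
theorem tendsto_leadingMinor_update_scaled {φ : ℕ → Fin n → ℝ} {w : ℕ → ℕ} {c : ℕ → ℝ}
    {i j k : ℕ} (hik : i < k) (hkj : k ≤ j) (h : ∀ a ≤ j, HasOrder H (φ a) (w a) (c a))
    (hc : c j ≠ 0) (hw : InjOn w (Iio k)) (hij : w j + 1 = w i) {σ : ℝ} (hσ : 0 < σ) :
    Tendsto (fun ε : ℝ => (ε * σ) ^ (∑ b ∈ Finset.range k, b) *
      ((ε * σ) ^ (∑ a ∈ Finset.range k, w a))⁻¹ *
      leadingMinor H (Function.update φ i (φ i - (ε * (c i / c j)) • φ j)) k (ε * σ)) (𝓝[>] 0)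
      (𝓝 ((∏ a ∈ Finset.range k, c a) * vandermondeDet w k *
        (1 - vandermondeRatio w i (w j) k / σ))) := by
  have hV := vandermondeDet_ne_zero hw
  have hik' : i ∈ Finset.range k := by simpa using hik
  have hlim : Tendsto (fun ε : ℝ => ε * σ) (𝓝[>] 0) (𝓝[>] 0) := by
    refine tendsto_nhdsWithin_iff.2 ⟨?_, ?_⟩
    · have : Tendsto (fun ε : ℝ => ε * σ) (𝓝 0) (𝓝 (0 * σ)) := by
        exact (continuous_mul_const σ).tendsto 0
      rw [zero_mul] at this
      exact this.mono_left nhdsWithin_le_nhds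
    · filter_upwards [self_mem_nhdsWithin] with ε hε using mul_pos hε hσ
  have t1 := (tendsto_leadingMinor (k := k) fun a ha => h a (by omega)).comp hlim
  have t2 := (tendsto_leadingMinor (H := H) (k := k) (φ := Function.update φ i (φ j))
    (w := Function.update w i (w j)) (c := Function.update c i (c j)) (fun a ha => by
      rcases eq_or_ne a i with rfl | hai
      · simpa using h j le_rfl
      · simpa [hai] using h a (by omega))).comp hlim
  have hsum : ∑ a ∈ Finset.range k, w a =
      ∑ a ∈ Finset.range k, Function.update w i (w j) a + 1 := by
    rw [Finset.sum_update_of_mem hik', ← Finset.add_sum_erase _ _ hik',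
      Finset.sdiff_singleton_eq_erase, ← hij]
    omega
  have hprod : (∏ a ∈ Finset.range k, Function.update c i (c j) a) * (c i / c j) =
      ∏ a ∈ Finset.range k, c a := by
    rw [Finset.prod_update_of_mem hik', ← Finset.mul_prod_erase _ _ hik',
      Finset.sdiff_singleton_eq_erase]
    field_simp
  -- The minor containing `φ j` in row `i` has total order one less, which costs a factor `(ε σ)⁻¹`;
  -- against the coefficient `ε (c i / c j)` this leaves `σ⁻¹ (c i / c j)`.
  have t3 := t1.sub (t2.const_mul (σ⁻¹ * (c i / c j)))
  refine (t3.congr' ?_).trans_eq ?_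
  · filter_upwards [self_mem_nhdsWithin] with ε hε
    have hε' : ε ≠ 0 := (mem_Ioi.1 hε).ne'
    rw [leadingMinor_update_sub φ hik, Function.update_eq_self, hsum]
    simp only [Function.comp_apply, pow_succ]
    have : (ε * σ) ^ (∑ a ∈ Finset.range k, Function.update w i (w j) a) ≠ 0 := by positivity
    field_simp
  · congr 1
    rw [← hprod]
    unfold vandermondeRatio
    field_simp

/-! ### Zeros that persist under perturbation. -/

/-- For all rows `ψ` close to `φ`, some leading minor of size less than `n` vanishes at no less
than `N` points of the interval `(α, R)`. -/
def HasManyZeros (H : ℕ → ℝ → Fin n → ℝ) (φ : ℕ → Fin n → ℝ) (α R : ℝ) (N : ℕ) : Prop :=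
  ∀ᶠ ψ in 𝓝 φ, (N : ℕ∞) ≤ {τ ∈ Ioo α R | ∃ k < n, leadingMinor H ψ k τ = 0}.encard

theorem HasManyZeros.add {φ : ℕ → Fin n → ℝ} {α β R : ℝ} {M N : ℕ} (hβα : β ≤ α) (hαR : α ≤ R)
    (h1 : HasManyZeros H φ β α M) (h2 : HasManyZeros H φ α R N) :
    HasManyZeros H φ β R (N + M) := by
  filter_upwards [h1, h2] with ψ h1 h2
  rw [add_comm N M]
  push_cast
  refine (add_le_add h1 h2).trans ?_
  rw [← encard_union_eq]
  · refine encard_le_encard ?_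
    rintro τ (⟨hτ, h⟩ | ⟨hτ, h⟩)
    · exact ⟨⟨hτ.1, hτ.2.trans_le hαR⟩, h⟩
    · exact ⟨⟨hβα.trans_lt hτ.1, hτ.2⟩, h⟩
  · rw [disjoint_left]
    rintro τ ⟨hτ, -⟩ ⟨hτ', -⟩
    exact lt_asymm hτ.2 hτ'.1

/-- Finitely many strict sign changes form an open condition on the rows. Each gap `(σ l, σ (l +
1))` then contains a zero, and the gaps are disjoint, so zeros of different minors are not counted
twice. -/
theorem hasManyZeros_of_sign_changes {φ : ℕ → Fin n → ℝ} {α β R : ℝ} {m : ℕ} {σ : ℕ → ℝ}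
    {k : ℕ → ℕ} (hH : ∀ b, ContinuousOn (H b) (Ioo 0 R)) (hβ : 0 < β) (hα : α ≤ R)
    (hσ : ∀ l < m, σ l < σ (l + 1)) (h0 : β < σ 0) (hm : σ m < α) (hk : ∀ l < m, k l < n)
    (hsign : ∀ l < m, leadingMinor H φ (k l) (σ l) * leadingMinor H φ (k l) (σ (l + 1)) < 0) :
    HasManyZeros H φ β α m := by
  have hev : ∀ᶠ ψ in 𝓝 φ, ∀ l ∈ Finset.range m,
      leadingMinor H ψ (k l) (σ l) * leadingMinor H ψ (k l) (σ (l + 1)) < 0 := by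
    rw [Finset.eventually_all]
    intro l hl
    exact (((continuous_leadingMinor_left (k l) (σ l)).mul
      (continuous_leadingMinor_left (k l) (σ (l + 1)))).tendsto φ).eventually_lt_const
        (hsign l (by simpa using hl))
  have hmono : ∀ l l', l ≤ l' → l' ≤ m → σ l ≤ σ l' := by
    intro l l' hll
    induction l', hll using Nat.le_induction with
    | base => exact fun _ => le_rfl
    | succ l' _ ih => exact fun h => (ih (by omega)).trans (hσ l' (by omega)).le
  filter_upwards [hev] with ψ hψ
  have hz : ∀ l, ∃ z, l < m → z ∈ Ioo (σ l) (σ (l + 1)) ∧ leadingMinor H ψ (k l) z = 0 := by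
    intro l
    by_cases hl : l < m
    swap
    · exact ⟨0, fun h => absurd h hl⟩
    have hneg := hψ l (by simpa using hl)
    have hlt := hσ l hl
    have hsub : uIcc (σ l) (σ (l + 1)) ⊆ Ioo 0 R := by
      rw [uIcc_of_le hlt.le]
      intro x hx
      have := hmono 0 l (by omega) (by omega)
      have := hmono (l + 1) m (by omega) (by omega)
      exact ⟨by linarith [hx.1], by linarith [hx.2]⟩
    have hmem : (0 : ℝ) ∈ uIcc (leadingMinor H ψ (k l) (σ l))
        (leadingMinor H ψ (k l) (σ (l + 1))) := by
      rw [mem_uIcc]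
      rcases mul_neg_iff.1 hneg with h | h
      · exact Or.inr ⟨h.2.le, h.1.le⟩
      · exact Or.inl ⟨h.1.le, h.2.le⟩
    obtain ⟨z, hz, hz0⟩ := intermediate_value_uIcc
      ((continuousOn_leadingMinor hH ψ (k l)).mono hsub) hmem
    rw [uIcc_of_le hlt.le] at hz
    refine ⟨z, fun _ => ⟨⟨lt_of_le_of_ne hz.1 ?_, lt_of_le_of_ne hz.2 ?_⟩, hz0⟩⟩
    · rintro rfl
      simp [hz0] at hneg
    · rintro rfl
      simp [hz0] at hneg
  choose z hz using hz
  have hzlt : ∀ l l', l < l' → l' < m → z l < z l' := fun l l' hll hl' =>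
    ((hz l (hll.trans hl')).1.2.trans_le (hmono _ _ hll hl'.le)).trans (hz l' hl').1.1
  have hinj : InjOn z (Iio m) := by
    intro l hl l' hl' e
    rcases lt_trichotomy l l' with h | h | h
    · exact absurd e (hzlt l l' h hl').ne
    · exact h
    · exact absurd e (hzlt l' l h hl).ne'
  have hcard : (m : ℕ∞) = (z '' Iio m).encard := by
    rw [hinj.encard_image, ← Finset.coe_range, encard_coe_eq_coe_finsetCard, Finset.card_range]
  rw [hcard]
  refine encard_le_encard ?_
  rintro _ ⟨l, hl, rfl⟩
  rw [mem_Iio] at hl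
  have h1 := hmono 0 l (by omega) (by omega)
  have h2 := hmono (l + 1) m (by omega) (by omega)
  have h3 := (hz l hl).1
  exact ⟨⟨by linarith [h3.1], by linarith [h3.2]⟩, k l, hk l hl, (hz l hl).2⟩

/-! ### Exchanging two consecutive orders. -/

/-- There are rows whose coordinates have the orders `w` at `0+`, and whose leading minors have
robustly `N` zeros in `(0, R)`. -/
def HasZerosOfOrders (H : ℕ → ℝ → Fin n → ℝ) (R : ℝ) (w : ℕ → ℕ) (N : ℕ) : Prop :=
  ∃ (φ : ℕ → Fin n → ℝ) (c : ℕ → ℝ) (α : ℝ), 0 < α ∧ α < R ∧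
    (∀ a < n, c a ≠ 0 ∧ HasOrder H (φ a) (w a) (c a)) ∧ HasManyZeros H φ α R N

/-- Points separating the terms of a finite increasing sequence of positive numbers. -/
theorem exists_separating (r : ℕ → ℝ) (m : ℕ) (h0 : 0 < m → 0 < r 0)
    (hr : ∀ l, l + 1 < m → r l < r (l + 1)) :
    ∃ σ : ℕ → ℝ, (∀ l ≤ m, 0 < σ l) ∧ ∀ l < m, σ l < r l ∧ r l < σ (l + 1) := by
  have hpos : ∀ l < m, 0 < r l := by
    intro l
    induction l with
    | zero => exact h0
    | succ l ih => exact fun h => (ih (by omega)).trans (hr l h)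
  refine ⟨fun l => match l with
    | 0 => if 0 < m then r 0 / 2 else 1
    | l + 1 => if l + 1 < m then (r l + r (l + 1)) / 2 else r l + 1, ?_, ?_⟩
  · rintro (_ | l) hl
    · dsimp only
      split_ifs with h
      · exact half_pos (h0 h)
      · exact one_pos
    · dsimp only
      have := hpos l (by omega)
      split_ifs with h
      · linarith [hpos _ h]
      · linarith
  · rintro (_ | l) hl
    · have h1 := h0 hl
      dsimp only
      rw [if_pos hl]
      refine ⟨by linarith, ?_⟩
      split_ifs with h
      · linarith [hr 0 h]
      · linarith
    · dsimp only
      rw [if_pos hl]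
      refine ⟨by linarith [hr l hl], ?_⟩
      split_ifs with h
      · linarith [hr _ h]
      · linarith

/-- The minors of sizes `i + 1, …, j` each acquire one zero below `α`; the old zeros lie above `α`.
The condition on the rows between `i` and `j` makes the Vandermonde ratios increase. -/
theorem HasZerosOfOrders.swap {R : ℝ} {w : ℕ → ℕ} {N i j : ℕ}
    (hH : ∀ b, ContinuousOn (H b) (Ioo 0 R)) (h : HasZerosOfOrders H R w N) (hij : i < j)
    (hjn : j < n) (hw : InjOn w (Iio n)) (hwij : w j + 1 = w i)
    (hbetween : ∀ l, i < l → l < j → w i < w l) :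
    HasZerosOfOrders H R (w ∘ Equiv.swap i j) (N + (j - i)) := by
  obtain ⟨φ, c, α, hα, hαR, hφ, hN⟩ := h
  have hin : i < n := hij.trans hjn
  have hinj : ∀ k ≤ n, InjOn w (Iio k) := fun k hk => hw.mono (Iio_subset_Iio hk)
  set r : ℕ → ℝ := fun k => vandermondeRatio w i (w j) k
  have hr0 : 0 < r (i + 1) := vandermondeRatio_self_succ_pos hwij (hinj _ hin) fun l hl e =>
    (hl.trans hij).ne (hw (by simp; omega) (by simpa using hjn) e)
  have hrpos : ∀ l, i + 1 + l ≤ j → 0 < r (i + 1 + l) := by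
    intro l
    induction l with
    | zero => exact fun _ => hr0
    | succ l ih =>
      intro hl
      exact (ih (by omega)).trans (vandermondeRatio_lt_succ hwij (by omega) (hinj _ (by omega))
        (hbetween _ (by omega) (by omega)) (ih (by omega)))
  obtain ⟨σ, hσpos, hσ⟩ := exists_separating (fun l => r (i + 1 + l)) (j - i) (fun _ => hr0)
    fun l hl => vandermondeRatio_lt_succ hwij (by omega) (hinj _ (by omega))
      (hbetween _ (by omega) (by omega)) (hrpos _ (by omega))
  have hci := (hφ i hin).1
  have hcj := (hφ j hjn).1
  set Φ : ℝ → ℕ → Fin n → ℝ :=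
    fun ε => Function.update φ i (φ i - (ε * (c i / c j)) • φ j) with hΦ
  have hΦ0 : Tendsto Φ (𝓝[>] 0) (𝓝 φ) := by
    have hcont : Continuous Φ := by
      refine continuous_const.update i ?_
      fun_prop
    have := hcont.tendsto 0
    rw [show Φ 0 = φ by simp [hΦ]] at this
    exact this.mono_left nhdsWithin_le_nhds
  have hold : ∀ᶠ ε in 𝓝[>] (0 : ℝ), HasManyZeros H (Φ ε) α R N :=
    hΦ0.eventually (eventually_eventually_nhds.2 hN)
  have hsign : ∀ᶠ ε in 𝓝[>] (0 : ℝ), ∀ l ∈ Finset.range (j - i),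
      leadingMinor H (Φ ε) (i + 1 + l) (ε * σ l) *
        leadingMinor H (Φ ε) (i + 1 + l) (ε * σ (l + 1)) < 0 := by
    rw [Finset.eventually_all]
    intro l hl
    rw [Finset.mem_range] at hl
    have p1 := hσpos l (by omega)
    have p2 := hσpos (l + 1) (by omega)
    have lim := fun (s : ℝ) (hs : 0 < s) => tendsto_leadingMinor_update_scaled (H := H)
      (k := i + 1 + l) (j := j) (by omega)
      (by omega) (fun a ha => (hφ a (by omega)).2) hcj (hinj _ (by omega)) hwij hs
    have hneg : (∏ a ∈ Finset.range (i + 1 + l), c a) * vandermondeDet w (i + 1 + l) *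
        (1 - vandermondeRatio w i (w j) (i + 1 + l) / σ l) *
        ((∏ a ∈ Finset.range (i + 1 + l), c a) * vandermondeDet w (i + 1 + l) *
        (1 - vandermondeRatio w i (w j) (i + 1 + l) / σ (l + 1))) < 0 := by
      have hC : (∏ a ∈ Finset.range (i + 1 + l), c a) * vandermondeDet w (i + 1 + l) ≠ 0 :=
        mul_ne_zero (Finset.prod_ne_zero_iff.2 fun a ha =>
          (hφ a (by rw [Finset.mem_range] at ha; omega)).1) (vandermondeDet_ne_zero (hinj _ (by omega)))
      rw [mul_mul_mul_comm]
      -- The limit factor `1 - ρ / σ` is negative to the left of `ρ` and positive to the right.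
      refine mul_neg_of_pos_of_neg (mul_self_pos.2 hC) (mul_neg_of_neg_of_pos ?_ ?_)
      · rw [sub_neg, one_lt_div p1]
        exact (hσ l hl).1
      · rw [sub_pos, div_lt_one p2]
        exact (hσ l hl).2
    filter_upwards [((lim _ p1).mul (lim _ p2)).eventually_lt_const hneg, self_mem_nhdsWithin]
      with ε hε hε0
    have hε0 : 0 < ε := hε0
    rw [mul_mul_mul_comm] at hε
    exact neg_of_mul_neg_right hε (by positivity)
  have hsmall : ∀ᶠ ε in 𝓝[>] (0 : ℝ), ε * σ (j - i) < α := by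
    have : Tendsto (fun ε : ℝ => ε * σ (j - i)) (𝓝[>] 0) (𝓝 (0 * σ (j - i))) :=
      ((continuous_mul_const _).tendsto 0).mono_left nhdsWithin_le_nhds
    rw [zero_mul] at this
    exact this.eventually_lt_const hα
  obtain ⟨ε, hε1, hε2, hε3, hε0⟩ :=
    (hold.and (hsign.and (hsmall.and self_mem_nhdsWithin))).exists
  have hε0 : 0 < ε := hε0
  have hσ0 := hσpos 0 (by omega)
  have hnew : HasManyZeros H (Φ ε) (ε * σ 0 / 2) α (j - i) := by
    refine hasManyZeros_of_sign_changes (σ := fun l => ε * σ l) (k := fun l => i + 1 + l) hH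
      (by positivity) hαR.le (fun l hl => ?_) (by have := mul_pos hε0 hσ0; linarith)
      hε3 (fun l hl => by omega) (fun l hl => hε2 l (by simpa using hl))
    exact mul_lt_mul_of_pos_left ((hσ l hl).1.trans (hσ l hl).2) hε0
  have hβα : ε * σ 0 / 2 < α := by
    have : ∀ l ≤ j - i, σ 0 ≤ σ l := by
      intro l
      induction l with
      | zero => exact fun _ => le_rfl
      | succ l ih =>
        intro hl
        exact (ih (by omega)).trans ((hσ l (by omega)).1.trans (hσ l (by omega)).2).le
    have := mul_le_mul_of_nonneg_left (this _ le_rfl) hε0.le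
    have := mul_pos hε0 hσ0
    linarith
  have hall : HasManyZeros H (Φ ε) (ε * σ 0 / 2) R (N + (j - i)) := hnew.add hβα.le hαR.le hε1
  set s : ℝ := ε * (c i / c j) with hs
  have hs0 : s ≠ 0 := by rw [hs]; exact mul_ne_zero hε0.ne' (div_ne_zero hci hcj)
  -- Row `i` now has order `w j`, so row `j` is replaced by the old `φ i`, of order `w i`, to keep
  -- the orders distinct.
  refine ⟨Function.update (Φ ε) j (φ i), Function.update (Function.update c i (-ε * c i)) j (c i),
    ε * σ 0 / 2, by positivity, hβα.trans hαR, fun a ha => ?_, ?_⟩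
  · rcases eq_or_ne a j with rfl | haj
    · simpa using hφ i hin
    rcases eq_or_ne a i with rfl | hai
    -- At order `w j` the form `φ i` has leading coefficient `0`, so that of the difference is `-s *
    -- c j = -ε * c i`.
    · have := (hwij ▸ (hφ a hin).2).of_succ.sub_smul (hφ j hjn).2 s
      rw [show 0 - s * c j = -ε * c a by rw [hs]; field_simp; ring] at this
      simpa [hij.ne, hΦ, hε0.ne', hci] using this
    · simpa [haj, hai, hΦ, Equiv.swap_apply_of_ne_of_ne] using hφ a ha
  -- `T` undoes the replacement of row `j` continuously. It fixes the minors of size at most `j` and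
  -- multiplies the larger ones by `s⁻¹`, so zeros for `T ψ` are zeros for `ψ`.
  · set T : (ℕ → Fin n → ℝ) → ℕ → Fin n → ℝ :=
      fun ψ => Function.update ψ j (s⁻¹ • (ψ j - ψ i)) with hT
    have hTc : Continuous T := by
      refine continuous_id.update j ?_
      fun_prop
    have hTφ : T (Function.update (Φ ε) j (φ i)) = Φ ε := by
      ext1 a
      rcases eq_or_ne a j with rfl | haj
      · simp [hT, hΦ, hij.ne, hij.ne', ← hs, smul_smul, hs0]
      · simp [hT, haj]
    have hlim := hTc.tendsto (Function.update (Φ ε) j (φ i))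
    rw [hTφ] at hlim
    filter_upwards [hlim.eventually hall] with ψ hψ
    refine hψ.trans (encard_le_encard ?_)
    rintro τ ⟨hτ, k, hk, hz⟩
    refine ⟨hτ, k, hk, ?_⟩
    rcases le_or_gt k j with hkj | hkj
    · rwa [hT, leadingMinor_update_of_le _ hkj] at hz
    · rw [hT, leadingMinor_update_smul_sub _ hij hkj] at hz
      exact (mul_eq_zero.1 hz).resolve_left (inv_ne_zero hs0)

theorem HasZerosOfOrders.congr {R : ℝ} {w w' : ℕ → ℕ} {N : ℕ} (h : HasZerosOfOrders H R w N)
    (hw : ∀ a < n, w a = w' a) : HasZerosOfOrders H R w' N := by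
  obtain ⟨φ, c, α, hα, hαR, hφ, hN⟩ := h
  exact ⟨φ, c, α, hα, hαR, fun a ha => hw a ha ▸ hφ a ha, hN⟩

/-! ### Selection sort and the count of zeros. -/

/-- The permutations of `0, …, n - 1` that sort the decreasing one by selection: the first `i`
values are sorted, and the `i`-th value has been decreased `r` times. -/
def sortingOrder (n i r a : ℕ) : ℕ :=
  if a < i then a else if a = i then n - 1 - r else if a ≤ i + r then n - (a - i)
  else n - 1 - (a - i)

theorem injOn_sortingOrder {n i r : ℕ} (h : i + r < n) : InjOn (sortingOrder n i r) (Iio n) := by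
  intro a ha b hb hab
  rw [mem_Iio] at ha hb
  unfold sortingOrder at hab
  split_ifs at hab <;> omega

theorem HasZerosOfOrders.sortingOrder_row {R : ℝ} {N i : ℕ}
    (hH : ∀ b, ContinuousOn (H b) (Ioo 0 R))
    (h : HasZerosOfOrders H R (sortingOrder n i 0) N) (r : ℕ) (hr : i + r < n) :
    HasZerosOfOrders H R (sortingOrder n i r) (N + ∑ l ∈ Finset.range r, (l + 1)) := by
  induction r with
  | zero => simpa using h
  | succ r ih =>
    -- Row `i` has order `n - 1 - r`, row `i + r + 1` has the next lower one, and the rows between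
    -- have larger orders; this swap adds `r + 1` zeros.
    have := (ih (by omega)).swap hH (i := i) (j := i + r + 1) (by omega) (by omega)
      (injOn_sortingOrder (by omega)) (by unfold sortingOrder; split_ifs <;> omega)
      (fun l h1 h2 => by unfold sortingOrder; split_ifs <;> omega)
    rw [show N + ∑ l ∈ Finset.range r, (l + 1) + (i + r + 1 - i) =
      N + ∑ l ∈ Finset.range (r + 1), (l + 1) by rw [Finset.sum_range_succ]; omega] at this
    refine this.congr fun a ha => ?_
    simp only [Function.comp_apply, Equiv.swap_apply_def]
    unfold sortingOrder
    split_ifs <;> omega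

theorem HasZerosOfOrders.sortingOrder_column {R : ℝ}
    (hH : ∀ b, ContinuousOn (H b) (Ioo 0 R))
    (h : HasZerosOfOrders H R (sortingOrder n 0 0) 0) (i : ℕ) (hi : i < n) :
    HasZerosOfOrders H R (sortingOrder n i 0)
      (∑ a ∈ Finset.range i, ∑ l ∈ Finset.range (n - 1 - a), (l + 1)) := by
  induction i with
  | zero => simpa using h
  | succ i ih =>
    -- After `n - 1 - i` decreases row `i` has its final order `i`, and the later rows are again
    -- decreasing from `n - 1`.
    have := (ih (by omega)).sortingOrder_row hH (n - 1 - i) (by omega)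
    rw [← Finset.sum_range_succ
      (fun a => ∑ l ∈ Finset.range (n - 1 - a), (l + 1))] at this
    refine this.congr fun a ha => ?_
    unfold sortingOrder
    split_ifs <;> omega

theorem six_mul_sum_sum_range (m : ℕ) :
    6 * ∑ a ∈ Finset.range m, ∑ l ∈ Finset.range (m - a), (l + 1) + (m + 1) = (m + 1) ^ 3 := by
  have h2 : ∀ m, 2 * ∑ l ∈ Finset.range m, (l + 1) = m * (m + 1) := by
    intro m
    induction m with
    | zero => simp
    | succ m ih => rw [Finset.sum_range_succ, mul_add, ih]; ring
  induction m with
  | zero => simp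
  | succ m ih =>
    rw [Finset.sum_range_succ']
    simp only [Nat.add_sub_add_right, Nat.sub_zero]
    linarith [h2 (m + 1)]

/-! ### Taylor asymptotics and the initial basis. -/

theorem tendsto_div_pow_of_iterated_deriv {f : ℕ → ℝ → ℝ} {R : ℝ} (hR : 0 < R)
    (hf : ∀ b, ∀ τ ∈ Ioo (-R) R, HasDerivAt (f b) (f (b + 1) τ) τ) {d : ℕ}
    (h0 : ∀ b < d, f b 0 = 0) :
    Tendsto (fun τ => f 0 τ / τ ^ d) (𝓝[>] 0) (𝓝 (f d 0 / d.factorial)) := by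
  have hc : ∀ f : ℕ → ℝ → ℝ, (∀ b, ∀ τ ∈ Ioo (-R) R, HasDerivAt (f b) (f (b + 1) τ) τ) →
      Tendsto (f 0) (𝓝[>] 0) (𝓝 (f 0 0)) := fun f hf =>
    (hf 0 0 ⟨by linarith, hR⟩).continuousAt.tendsto.mono_left nhdsWithin_le_nhds
  induction d generalizing f with
  | zero => simpa using hc f hf
  | succ d ih =>
    have h1 := ih (f := fun b => f (b + 1)) (fun b => hf (b + 1)) (fun b hb => h0 _ (by omega))
    have hnear : ∀ᶠ τ in 𝓝[>] (0 : ℝ), τ ∈ Ioo (-R) R :=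
      nhdsWithin_le_nhds (Ioo_mem_nhds (by linarith) hR)
    refine HasDerivAt.lhopital_zero_nhdsGT (f' := f 1)
      (g' := fun τ => ((d + 1 : ℕ) : ℝ) * τ ^ d) ?_ ?_ ?_ ?_ ?_ ?_
    · exact hnear.mono fun τ hτ => hf 0 τ hτ
    · exact Eventually.of_forall fun τ => by simpa using hasDerivAt_pow (d + 1) τ
    · filter_upwards [self_mem_nhdsWithin] with τ hτ
      have : 0 < τ := hτ
      positivity
    · simpa [h0 0 (by omega)] using hc f hf
    · have : Tendsto (fun τ : ℝ => τ ^ (d + 1)) (𝓝 0) (𝓝 (0 ^ (d + 1))) :=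
        (continuous_pow (d + 1)).tendsto 0
      rw [zero_pow (by omega)] at this
      exact this.mono_left nhdsWithin_le_nhds
    · have h2 := h1.div_const ((d + 1 : ℕ) : ℝ)
      rw [Nat.factorial_succ]
      refine (h2.congr fun τ => ?_).trans_eq ?_
      · simp only [zero_add]
        rw [div_div, mul_comm]
      · rw [div_div, Nat.cast_mul, mul_comm]

theorem hasOrder_of_deriv {R : ℝ} (hR : 0 < R)
    (hH : ∀ b, ∀ τ ∈ Ioo (-R) R, HasDerivAt (H b) (H (b + 1) τ) τ) {x : Fin n → ℝ} {w : ℕ}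
    (h0 : ∀ b < w, x ⬝ᵥ H b 0 = 0) (h1 : x ⬝ᵥ H w 0 = 1) :
    HasOrder H x w (1 / (w.factorial : ℝ)) := by
  have hd : ∀ b, ∀ τ ∈ Ioo (-R) R, HasDerivAt (fun τ => x ⬝ᵥ H b τ) (x ⬝ᵥ H (b + 1) τ) τ := by
    intro b τ hτ
    unfold dotProduct
    exact HasDerivAt.fun_sum fun i _ => ((hasDerivAt_pi.1 (hH b τ hτ)) i).const_mul _
  intro b
  rcases le_or_gt b w with hb | hb
  · have := tendsto_div_pow_of_iterated_deriv (f := fun a τ => x ⬝ᵥ H (b + a) τ) hR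
      (fun a => hd (b + a)) (d := w - b) (fun a ha => h0 _ (by omega))
    refine (this.congr' ?_).trans_eq ?_
    · filter_upwards [self_mem_nhdsWithin] with τ hτ
      have : τ ≠ 0 := (mem_Ioi.1 hτ).ne'
      rw [pow_sub₀ τ this hb, Nat.add_zero]
      field_simp
    · rw [Nat.add_sub_cancel' hb, h1, ← Nat.factorial_mul_descFactorial hb]
      have h2 : (w.descFactorial b : ℝ) ≠ 0 := by
        exact_mod_cast mt Nat.descFactorial_eq_zero_iff_lt.1 hb.not_gt
      congr 1
      push_cast
      field_simp
  -- For `b > w` the prescribed limit is `0`, and the positive power `τ ^ (b - w)` times a bounded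
  -- quantity tends to it.
  · rw [Nat.descFactorial_of_lt hb]
    have h2 : Tendsto (fun τ => x ⬝ᵥ H b τ) (𝓝[>] 0) (𝓝 (x ⬝ᵥ H b 0)) :=
      (hd b 0 ⟨by linarith, hR⟩).continuousAt.tendsto.mono_left nhdsWithin_le_nhds
    have h3 : Tendsto (fun τ : ℝ => τ ^ (b - w)) (𝓝[>] 0) (𝓝 (0 ^ (b - w))) :=
      ((continuous_pow (b - w)).tendsto 0).mono_left nhdsWithin_le_nhds
    have h4 := h3.mul h2
    rw [zero_pow (by omega), zero_mul] at h4
    rw [Nat.cast_zero, mul_zero]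
    refine h4.congr' ?_
    filter_upwards [self_mem_nhdsWithin] with τ hτ
    rw [pow_sub₀ τ (mem_Ioi.1 hτ).ne' hb.le]

theorem hasZerosOfOrders_zero {R : ℝ} (hR : 0 < R)
    (hH : ∀ b, ∀ τ ∈ Ioo (-R) R, HasDerivAt (H b) (H (b + 1) τ) τ)
    (hdet : (Matrix.of fun b : Fin n => H b 0).det ≠ 0) :
    HasZerosOfOrders H R (sortingOrder n 0 0) 0 := by
  set M : Matrix (Fin n) (Fin n) ℝ := Matrix.of fun b : Fin n => H b 0 with hM
  have hinv : M * M⁻¹ = 1 := Matrix.mul_nonsing_inv M (isUnit_iff_ne_zero.2 hdet)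
  have hdual : ∀ b v : Fin n, (fun i => M⁻¹ i v) ⬝ᵥ H b 0 = (1 : Matrix (Fin n) (Fin n) ℝ) b v := by
    intro b v
    rw [← hinv, Matrix.mul_apply, dotProduct_comm]
    rfl
  have hlt : ∀ a, a < n → n - 1 - a < n := fun a ha => by omega
  -- The basis dual to `H 0 0, …, H (n-1) 0`, in reverse order; with no zeros required yet, any `α`
  -- in `(0, R)` would do.
  refine ⟨fun a => if h : a < n then fun i => M⁻¹ i ⟨n - 1 - a, hlt a h⟩ else 0,
    fun a => 1 / ((n - 1 - a).factorial : ℝ), R / 2, by linarith, by linarith, fun a ha => ⟨?_, ?_⟩,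
    Eventually.of_forall fun _ => by simp⟩
  · positivity
  · have : sortingOrder n 0 0 a = n - 1 - a := by unfold sortingOrder; split_ifs <;> omega
    rw [this]
    simp only [dif_pos ha]
    refine hasOrder_of_deriv hR hH (fun b hb => ?_) ?_
    · have := hdual ⟨b, by omega⟩ ⟨n - 1 - a, hlt a ha⟩
      rwa [Matrix.one_apply_ne (fun e => hb.ne (congrArg Fin.val e))] at this
    · have := hdual ⟨n - 1 - a, hlt a ha⟩ ⟨n - 1 - a, hlt a ha⟩
      rwa [Matrix.one_apply_eq] at this

/-- The analytic core: for a nondegenerate curve with derivatives `H b` there is a basis of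
coordinates whose leading minors have `(n ^ 3 - n) / 6` distinct zeros in `(0, R)`. -/
theorem exists_basis_leadingMinor_zeros (hn : 0 < n) {R : ℝ} (hR : 0 < R)
    (hH : ∀ b, ∀ τ ∈ Ioo (-R) R, HasDerivAt (H b) (H (b + 1) τ) τ)
    (hdet : (Matrix.of fun b : Fin n => H b 0).det ≠ 0) :
    ∃ φ : ℕ → Fin n → ℝ, (Matrix.of fun a : Fin n => φ a).det ≠ 0 ∧
      (((n ^ 3 - n) / 6 : ℕ) : ℕ∞) ≤
        {τ ∈ Ioo 0 R | ∃ k < n, leadingMinor H φ k τ = 0}.encard := by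
  have hcont : ∀ b, ContinuousOn (H b) (Ioo 0 R) := fun b τ hτ =>
    (hH b τ ⟨by linarith [hτ.1], hτ.2⟩).continuousAt.continuousWithinAt
  obtain ⟨φ, c, α, hα, hαR, hφ, hN⟩ :=
    (hasZerosOfOrders_zero hR hH hdet).sortingOrder_column hcont (n - 1) (by omega)
  refine ⟨φ, fun h0 => ?_, ?_⟩
  -- The full `n × n` minor has a nonzero rescaled limit because the orders are distinct, so the
  -- rows must be independent.
  · have hlim := tendsto_leadingMinor (k := n) fun a ha => (hφ a ha).2
    have hne := mul_ne_zero (Finset.prod_ne_zero_iff.2 fun a ha =>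
      (hφ a (Finset.mem_range.1 ha)).1)
      (vandermondeDet_ne_zero (injOn_sortingOrder (n := n) (i := n - 1) (r := 0) (by omega)))
    obtain ⟨τ, hτ⟩ := (hlim.eventually_ne hne).exists
    refine hτ (mul_eq_zero_of_right _ ?_)
    have : (Matrix.of fun a b : Fin n => φ a ⬝ᵥ H b τ) =
        (Matrix.of fun a : Fin n => φ a) * (Matrix.of fun b : Fin n => H b τ).transpose := by
      ext a b
      rfl
    rw [leadingMinor, this, Matrix.det_mul, h0, zero_mul]
  · have hcount : (n ^ 3 - n) / 6 =
        ∑ a ∈ Finset.range (n - 1), ∑ l ∈ Finset.range (n - 1 - a), (l + 1) := by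
      have := six_mul_sum_sum_range (n - 1)
      rw [Nat.sub_add_cancel hn] at this
      omega
    rw [hcount]
    refine hN.self_of_nhds.trans (encard_le_encard ?_)
    exact fun τ hτ => ⟨⟨hα.trans hτ.1.1, hτ.1.2⟩, hτ.2⟩

/-! ### From vanishing minors to non-transversal flags. -/

/-- The vectors annihilated by the first `m` rows of `φ`. -/
def commonKernel (φ : ℕ → Fin n → ℝ) (m : ℕ) : Submodule ℝ (Fin n → ℝ) :=
  LinearMap.ker (Matrix.of fun a : Fin m => φ a).mulVecLin

theorem mem_commonKernel {φ : ℕ → Fin n → ℝ} {m : ℕ} {v : Fin n → ℝ} :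
    v ∈ commonKernel φ m ↔ ∀ a < m, φ a ⬝ᵥ v = 0 := by
  rw [commonKernel, LinearMap.mem_ker, Matrix.mulVecLin_apply, funext_iff]
  exact ⟨fun h a ha => h ⟨a, ha⟩, fun h a => h a a.2⟩

theorem finrank_commonKernel {φ : ℕ → Fin n → ℝ}
    (hφ : (Matrix.of fun a : Fin n => φ a).det ≠ 0) {m : ℕ} (hm : m ≤ n) :
    Module.finrank ℝ (commonKernel φ m) = n - m := by
  have hsurj : Function.Surjective (Matrix.of fun a : Fin m => φ a).mulVecLin := by
    intro y
    refine ⟨((Matrix.of fun a : Fin n => φ a)⁻¹).mulVec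
      (fun a : Fin n => if h : (a : ℕ) < m then y ⟨a, h⟩ else 0), ?_⟩
    have h1 : (Matrix.of fun a : Fin n => φ a).mulVec (((Matrix.of fun a : Fin n => φ a)⁻¹).mulVec
        (fun a : Fin n => if h : (a : ℕ) < m then y ⟨a, h⟩ else 0)) =
        fun a : Fin n => if h : (a : ℕ) < m then y ⟨a, h⟩ else 0 := by
      rw [Matrix.mulVec_mulVec, Matrix.mul_nonsing_inv _ (isUnit_iff_ne_zero.2 hφ),
        Matrix.one_mulVec]
    ext a
    have h2 := congrFun h1 ⟨a, a.2.trans_le hm⟩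
    simp only [Fin.is_lt, dif_pos] at h2
    exact h2
  have h := LinearMap.finrank_range_add_finrank_ker (Matrix.of fun a : Fin m => φ a).mulVecLin
  rw [LinearMap.range_eq_top.2 hsurj, finrank_top, Module.finrank_fin_fun,
    Module.finrank_fin_fun] at h
  unfold commonKernel
  omega

/-- The complete flag whose subspace of dimension `i` is cut out by the first `n - i` rows. -/
def CompleteFlag.ofRows (φ : ℕ → Fin n → ℝ) (hφ : (Matrix.of fun a : Fin n => φ a).det ≠ 0) :
    CompleteFlag n where
  subspace i := commonKernel φ (n - i)
  mono i j hij v hv := by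
    rw [mem_commonKernel] at hv ⊢
    exact fun a ha => hv a (by have : (i : ℕ) ≤ j := hij; omega)
  finrank_eq i := by
    rw [finrank_commonKernel hφ (Nat.sub_le _ _)]
    omega

/-- A kernel vector of the singular minor gives the coefficients of a combination of `H 0 τ, …, H
(k-1) τ` killed by the first `k` rows; it is nonzero since these vectors are independent. -/
theorem exists_mem_commonKernel_of_leadingMinor_eq_zero {H : ℕ → ℝ → Fin n → ℝ}
    {φ : ℕ → Fin n → ℝ} {k : ℕ} {τ : ℝ} (hk : k ≤ n)
    (hdet : (Matrix.of fun b : Fin n => H b τ).det ≠ 0) (h : leadingMinor H φ k τ = 0) :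
    ∃ v ≠ 0, v ∈ commonKernel φ k ∧ v ∈ Submodule.span ℝ {v | ∃ j < k, v = H j τ} := by
  obtain ⟨y, hy0, hy⟩ := Matrix.exists_mulVec_eq_zero_iff.2 h
  have hli : LinearIndependent ℝ fun b : Fin k => H b τ := by
    have := (Matrix.linearIndependent_rows_of_isUnit
      ((Matrix.isUnit_iff_isUnit_det _).2 (isUnit_iff_ne_zero.2 hdet))).comp (Fin.castLE hk)
      (Fin.castLE_injective hk)
    exact this
  refine ⟨∑ b, y b • H b τ, fun h0 => hy0 ?_, mem_commonKernel.2 fun a ha => ?_,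
    Submodule.sum_mem _ fun b _ => Submodule.smul_mem _ _ (Submodule.subset_span ⟨b, b.2, rfl⟩)⟩
  · exact funext (Fintype.linearIndependent_iff.1 hli y h0)
  · have := congrFun hy ⟨a, ha⟩
    rw [dotProduct_sum]
    simp only [dotProduct_smul, smul_eq_mul]
    simpa [Matrix.mulVec, dotProduct, mul_comm] using this

/-! ### Local lifts and the use of convexity. -/

theorem iteratedDerivWithin_eq_of_mem_interior {E : Type*} [NormedAddCommGroup E]
    [NormedSpace ℝ E] (f : ℝ → E) {D : Set ℝ} {t : ℝ} (ht : t ∈ interior D) (k : ℕ) :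
    iteratedDerivWithin k f D t = iteratedDeriv k f t := by
  have : D =ᶠ[𝓝 t] univ := by
    filter_upwards [mem_interior_iff_mem_nhds.1 ht] with s hs
    exact propext ⟨fun _ => trivial, fun _ => hs⟩
  rw [iteratedDerivWithin, iteratedDeriv, iteratedFDerivWithin_congr_set this,
    iteratedFDerivWithin_univ]

theorem iteratedDeriv_continuousLinearMap_comp {E F : Type*} [NormedAddCommGroup E]
    [NormedSpace ℝ E] [NormedAddCommGroup F] [NormedSpace ℝ F] (L : E →L[ℝ] F) {f : ℝ → E} {t : ℝ}
    (hf : ContDiffAt ℝ ∞ f t) (k : ℕ) :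
    iteratedDeriv k (fun s => L (f s)) t = L (iteratedDeriv k f t) := by
  exact DFunLike.congr_fun (L.iteratedFDeriv_comp_left hf (i := k) (by exact_mod_cast le_top))
    fun _ => 1

/-- At a point of convexity, the derivatives of order less than `n` of a lift are linearly
independent. -/
theorem det_iteratedDeriv_ne_zero {γ : ℝ → Projectivization ℝ (Fin n → ℝ)} {D P : Set ℝ}
    (hγ : IsConvexWith γ D P) (hn : 0 < n) {t : ℝ} (htP : t ∈ P) (htD : t ∈ interior D)
    {g : ℝ → Fin n → ℝ} (hg : IsLocalLift γ D t g) (hgt : ContDiffAt ℝ ∞ g t) :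
    (Matrix.of fun b : Fin n => iteratedDeriv b g t).det ≠ 0 := by
  intro h0
  -- The vector `v` is normal to a hyperplane containing all `n` derivatives, which forces
  -- multiplicity at least `n`.
  obtain ⟨v, hv0, hv⟩ := Matrix.exists_mulVec_eq_zero_iff.2 h0
  let L : (Fin n → ℝ) →L[ℝ] ℝ := LinearMap.toContinuousLinearMap
    { toFun := fun x => x ⬝ᵥ v
      map_add' := fun x y => add_dotProduct x y v
      map_smul' := fun c x => smul_dotProduct c x v }
  have hL : (L : Module.Dual ℝ (Fin n → ℝ)) ≠ 0 := fun e =>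
    hv0 (dotProduct_self_eq_zero.1 (LinearMap.congr_fun e v))
  have h1 := hγ.2 L hL {t} (by simpa using htP)
  rw [Finset.sum_singleton] at h1
  have h2 : (n : ℕ∞) ≤ localMultiplicity γ D L t := by
    refine le_iSup₂_of_le n ⟨g, hg, fun j hj => ?_⟩ le_rfl
    rw [iteratedDerivWithin_eq_of_mem_interior _ htD]
    exact (iteratedDeriv_continuousLinearMap_comp L hgt j).trans (congrFun hv ⟨j, hj⟩)
  have h3 : (n : ℕ∞) ≤ ((n - 1 : ℕ) : ℕ∞) := h2.trans h1
  have : n ≤ n - 1 := by exact_mod_cast h3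
  omega

/-- Serves both the circle (`D` the line, `P = [0, 1)`) and intervals (`D = P`). The arc is
half-open because only its interior in `D` matters: `t₀` may be an endpoint of `P`. -/
theorem exists_flag_momentsWith_ge {γ : ℝ → Projectivization ℝ (Fin n → ℝ)} {D P : Set ℝ}
    (hγ : IsConvexWith γ D P) {t₀ r : ℝ} (hr : 0 < r) (hP : Ico t₀ (t₀ + r) ⊆ P)
    (hD : Ico t₀ (t₀ + r) ⊆ interior D) :
    ∃ f : CompleteFlag n, (((n ^ 3 - n) / 6 : ℕ) : ℕ∞) ≤ momentsWith γ D P f := by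
  -- For `n = 0` the projective space is empty, so there is no curve.
  have hn : 0 < n := by
    rcases Nat.eq_zero_or_pos n with rfl | h
    · exact absurd (Subsingleton.elim _ _) (γ t₀).rep_nonzero
    · exact h
  have ht₀ : t₀ ∈ Ico t₀ (t₀ + r) := ⟨le_rfl, by linarith⟩
  obtain ⟨g, U, hU, htU, hgU, hgγ⟩ := hγ.1 t₀ (interior_subset (hD ht₀))
  obtain ⟨δ, hδ, hball⟩ := Metric.isOpen_iff.1 (hU.inter isOpen_interior) t₀ ⟨htU, hD ht₀⟩
  have hlift : ∀ t ∈ U, IsLocalLift γ D t g := fun t ht => ⟨U, hU, ht, hgU, hgγ⟩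
  have hsmooth : ∀ t ∈ U ∩ interior D, ContDiffAt ℝ ∞ g t := fun t ht =>
    hgU.contDiffAt (inter_mem (hU.mem_nhds ht.1) (mem_interior_iff_mem_nhds.1 ht.2))
  set R := min δ r with hRdef
  have hR : 0 < R := lt_min hδ hr
  have hmem : ∀ τ ∈ Ioo (-R) R, t₀ + τ ∈ U ∩ interior D := fun τ hτ => hball (by
    rw [Metric.mem_ball, Real.dist_eq, add_sub_cancel_left]
    exact (abs_lt.2 hτ).trans_le (min_le_left _ _))
  have hmemP : ∀ τ ∈ Ico 0 R, t₀ + τ ∈ P := fun τ hτ =>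
    hP ⟨by linarith [hτ.1], by linarith [hτ.2, min_le_right δ r]⟩
  let H : ℕ → ℝ → Fin n → ℝ := fun b τ => iteratedDeriv b g (t₀ + τ)
  have hderiv : ∀ b, ∀ τ ∈ Ioo (-R) R, HasDerivAt (H b) (H (b + 1) τ) τ := by
    intro b τ hτ
    have h1 : DifferentiableAt ℝ (iteratedDeriv b g) (t₀ + τ) := by
      have := (hsmooth _ (hmem τ hτ)).contDiffWithinAt (s := univ)
      have := this.differentiableWithinAt_iteratedDerivWithin (m := b)
        (by exact_mod_cast WithTop.coe_lt_coe.2 (ENat.natCast_lt_top b))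
        (by simp)
      rwa [iteratedDerivWithin_univ, differentiableWithinAt_univ] at this
    have h2 := h1.hasDerivAt
    rw [← iteratedDeriv_succ] at h2
    exact h2.comp_const_add t₀ τ
  have hdet : ∀ τ ∈ Ico 0 R, (Matrix.of fun b : Fin n => H b τ).det ≠ 0 := fun τ hτ => by
    have h1 := hmem τ ⟨by linarith [hτ.1], hτ.2⟩
    exact det_iteratedDeriv_ne_zero hγ hn (hmemP τ hτ) h1.2 (hlift _ h1.1) (hsmooth _ h1)
  obtain ⟨φ, hφ, hzeros⟩ := exists_basis_leadingMinor_zeros hn hR hderiv (hdet 0 ⟨le_rfl, hR⟩)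
  refine ⟨CompleteFlag.ofRows φ hφ, hzeros.trans ?_⟩
  rw [← (add_right_injective t₀).injOn.encard_image, momentsWith]
  refine encard_le_encard ?_
  rintro _ ⟨τ, ⟨hτ, k, hk, hz⟩, rfl⟩
  have hτ' : τ ∈ Ico 0 R := ⟨hτ.1.le, hτ.2⟩
  have hmemτ := hmem τ ⟨by linarith [hτ.1], hτ.2⟩
  refine ⟨hmemP τ hτ', fun htrans => ?_⟩
  obtain ⟨v, hv0, hvφ, hvH⟩ := exists_mem_commonKernel_of_leadingMinor_eq_zero hk.le (hdet τ hτ') hz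
  have hbot := htrans ⟨k, by omega⟩ ⟨n - k, by omega⟩ (by simp only; omega)
  refine hv0 ((Submodule.mem_bot ℝ).1 (hbot ▸ Submodule.mem_inf.2 ⟨?_, ?_⟩))
  · refine Submodule.span_mono ?_ hvH
    rintro _ ⟨j, hj, rfl⟩
    exact ⟨g, hlift _ hmemτ.1, j, hj, (iteratedDerivWithin_eq_of_mem_interior _ hmemτ.2 j).symm⟩
  · simpa only [CompleteFlag.ofRows, Nat.sub_sub_self hk.le] using hvφ

end ConvexCurve

theorem corollary4 (n : ℕ) :
    (∀ γ : UnitAddCircle → Projectivization ℝ (Fin n → ℝ), ConvexCurve.IsConvexClosed γ →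
      (∃ f : ConvexCurve.CompleteFlag n,
        (((n ^ 3 - n) / 6 : ℕ) : ℕ∞) ≤ ConvexCurve.momentsClosed γ f) ∧
      (((n ^ 3 - n) / 6 : ℕ) : ℕ∞) ≤ ConvexCurve.sharpClosed γ) ∧
    (∀ I : Set ℝ, I.OrdConnected → I.Nontrivial →
      ∀ γ : ℝ → Projectivization ℝ (Fin n → ℝ), ConvexCurve.IsConvexOn I γ →
      (∃ f : ConvexCurve.CompleteFlag n,
        (((n ^ 3 - n) / 6 : ℕ) : ℕ∞) ≤ ConvexCurve.momentsOn I γ f) ∧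
      (((n ^ 3 - n) / 6 : ℕ) : ℕ∞) ≤ ConvexCurve.sharpOn I γ) := by
  refine ⟨fun γ hγ => ?_, fun I hI hnt γ hγ => ?_⟩
  · obtain ⟨f, hf⟩ := ConvexCurve.exists_flag_momentsWith_ge hγ (t₀ := 0) one_pos (by simp)
      (by simp)
    exact ⟨⟨f, hf⟩, hf.trans (le_iSup (fun f => ConvexCurve.momentsClosed γ f) f)⟩
  · obtain ⟨a, ha, b, hb, hab⟩ := hnt.exists_lt
    have hsub : Set.Ioo a b ⊆ I := Set.Ioo_subset_Icc_self.trans (hI.out ha hb)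
    -- Starting at the midpoint of `(a, b)` keeps the whole arc, including its left end, in the
    -- interior of `I`.
    have hint : Set.Ico ((a + b) / 2) ((a + b) / 2 + (b - a) / 2) ⊆ interior I := fun t ht =>
      interior_maximal hsub isOpen_Ioo ⟨by linarith [ht.1], by linarith [ht.2]⟩
    obtain ⟨f, hf⟩ := ConvexCurve.exists_flag_momentsWith_ge hγ (r := (b - a) / 2) (by linarith)
      (hint.trans interior_subset) hint
    exact ⟨⟨f, hf⟩, hf.trans (le_iSup (fun f => ConvexCurve.momentsOn I γ f) f)⟩
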